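/- Let $\mathbb N=\{1,2,3,\dots\}$. For nonempty finite sets $H,K\subseteq\mathbb N$ write $H<K$ if $\max H<\min K$. A set $A\subseteq\mathbb N$ is an $IP$-set if there is a sequence $(x_t)_{t\ge 1}$ in $\mathbb N$ such that $\sum_{t\in H}x_t\in A$ for every nonempty finite $H\subseteq\mathbb N$; it is an $IP^\star$-set if it meets every $IP$-set. For $n\in\mathbb N$, a set $A\subseteq\mathbb N$ is an $IP^n$-set if there are sequences $(x_{i,t})_{t\ge1}$ in $\mathbb N$, $1\le i\le n$, such that $\sum_{i=1}^n\sum_{t\in H_i}x_{i,t}\in A$ for all nonempty finite sets $H_1<H_2<\dots<H_n$ in $\mathbb N$; it is an $IP^{n\star}$-set if it meets every $IP^n$-set in $\mathbb N$. Let $(X,\mathcal B,\mu,T)$ be a measure preserving system: $(X,\mathcal B,\mu)$ is a probability space and $T:X\to X$ is a (not necessarily invertible) measurable map with $\mu(T^{-1}B)=\mu(B)$ for all $B\in\mathcal B$. It is called mild mixing if for all $\varepsilon>0$ and all $A,B\in\mathcal B$ with $\mu(A)\mu(B)>0$ the set $\{m\in\mathbb N:|\mu(A\cap T^{-m}B)-\mu(A)\mu(B)|<\varepsilon\}$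 is an $IP^\star$-set. **Corollary.** Let $k,n\in\mathbb N$, let $(X,\mathcal B,\mu,T)$ be a mild mixing system, and let $A_0,A_1,\dots,A_k\in\mathcal B$ with $\mu(A_0)\mu(A_1)\cdots\mu(A_k)>0$. Then $$\Big\{m\in\mathbb N:\mu\Big(\bigcap_{i=0}^k T^{-im}A_i\Big)>0\Big\}$$ is an $IP^{n\star}$-set. -/

import Mathlib

open MeasureTheory

/-- A set `A` of positive integers is an IP-set if it contains all finite sums (over nonempty
finite index sets) of some infinite sequence of positive integers. -/
def IsIPSet (A : Set ℕ) : Prop :=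
  ∃ x : ℕ → ℕ, (∀ t, 0 < x t) ∧
    ∀ H : Finset ℕ, H.Nonempty → ∑ t ∈ H, x t ∈ A

/-- A set is an IP⋆-set if it meets every IP-set of positive integers. -/
def IsIPStarSet (A : Set ℕ) : Prop :=
  ∀ B : Set ℕ, (∀ b ∈ B, 0 < b) → IsIPSet B → (A ∩ B).Nonempty

/-- A set `A` is an IPⁿ-set if there are `n` sequences `x 1, …, x n` of positive integers such that
`A` contains all sums `∑ i, ∑ t ∈ H i, x i t` with nonempty finite sets `H 1 < H 2 < ⋯ < H n`,
where `H < K` means that every element of `H` is smaller than every element of `K`. -/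
def IsIPnSet (n : ℕ) (A : Set ℕ) : Prop :=
  ∃ x : Fin n → ℕ → ℕ, (∀ i t, 0 < x i t) ∧
    ∀ H : Fin n → Finset ℕ, (∀ i, (H i).Nonempty) →
      (∀ i j, i < j → ∀ s ∈ H i, ∀ t ∈ H j, s < t) →
      ∑ i, ∑ t ∈ H i, x i t ∈ A

/-- A set is an IPⁿ⋆-set if it meets every IPⁿ-set of positive integers. -/
def IsIPnStarSet (n : ℕ) (A : Set ℕ) : Prop :=
  ∀ B : Set ℕ, (∀ b ∈ B, 0 < b) → IsIPnSet n B → (A ∩ B).Nonempty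

/-- The map `T` makes the probability space `(X, μ)` a mild mixing measure preserving system. -/
structure IsMildMixing {X : Type*} [MeasurableSpace X] (μ : Measure X) (T : X → X) : Prop where
  isProbabilityMeasure : IsProbabilityMeasure μ
  measurePreserving : MeasurePreserving T μ μ
  isIPStarSet : ∀ ε : ℝ, 0 < ε → ∀ A B : Set X, MeasurableSet A → MeasurableSet B →
    0 < μ A * μ B →
    IsIPStarSet {n : ℕ | 0 < n ∧ |μ.real (A ∩ T^[n] ⁻¹' B) - μ.real A * μ.real B| < ε}

open Filter Topology

attribute [local instance] Ultrafilter.add Ultrafilter.addSemigroup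

/-! ### Idempotent ultrafilters and IP-sets -/

/-! By Hindman's theorem, IP⋆-sets are the sets lying in every idempotent ultrafilter `U` on the
positive integers, so mild mixing says that correlations converge to products along each such `U`.
The van der Corput lemma along `U` (`tendsto_inner_zero_of_idempotent`) and induction on `k` upgrade
this to mixing of all orders (`IsMildMixing.tendsto_integral_prod`), whence the return times form an
IP⋆-set. For IPⁿ, freeze all index sets but the last: the given set then contains `c + s` for all
finite sums `s` of one sequence. The IP⋆ statement for the sets `T^{-ic} A_i`, of the same measure
as `A_i`, yields an `s` for which `c + s` is a return time. -/

theorem Hindman.exists_finset_sum_eq_of_mem_FS {a : Stream' ℕ} {m : ℕ} (hm : m ∈ Hindman.FS a) :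
    ∃ H : Finset ℕ, H.Nonempty ∧ ∑ t ∈ H, a.get t = m := by
  have shift (a : Stream' ℕ) (H : Finset ℕ) :
      ∑ t ∈ H.map (addRightEmbedding 1), a.get t = ∑ t ∈ H, a.tail.get t := by
    simp [Finset.sum_map, Stream'.get_tail]
  induction hm with
  | head' a => exact ⟨{0}, by simp, by simp [Stream'.head]⟩
  | tail' a m _ ih =>
    obtain ⟨H, hH, rfl⟩ := ih
    exact ⟨H.map (addRightEmbedding 1), by simpa using hH, shift a H⟩
  | cons' a m _ ih =>
    obtain ⟨H, hH, rfl⟩ := ih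
    refine ⟨insert 0 (H.map (addRightEmbedding 1)), by simp, ?_⟩
    rw [Finset.sum_insert (by simp), shift, Stream'.head]

/-- Every member of an idempotent ultrafilter living on the positive integers meets each
IP⋆-set, so IP⋆-sets belong to such ultrafilters. -/
theorem IsIPStarSet.mem_ultrafilter {A : Set ℕ} (hA : IsIPStarSet A) {U : Ultrafilter ℕ}
    (hU : U + U = U) (hpos : ∀ᶠ m in U, 0 < m) : A ∈ U := by
  by_contra hAU
  have hc : Aᶜ ∩ {m | 0 < m} ∈ U :=
    Filter.inter_mem (Ultrafilter.compl_mem_iff_notMem.mpr hAU) hpos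
  obtain ⟨a, ha⟩ := Hindman.exists_FS_of_large U hU _ hc
  obtain ⟨m, hmA, hm⟩ := hA (Hindman.FS a) (fun b hb => (ha hb).2)
    ⟨a.get, fun t => (ha (Hindman.FS.singleton a t)).2, fun H hH => Hindman.FS.finsetSum a H hH⟩
  exact (ha hm).1 hmA

/-- A set belonging to every idempotent ultrafilter on the positive integers is an IP⋆-set. -/
theorem isIPStarSet_of_forall_ultrafilter {A : Set ℕ}
    (hA : ∀ U : Ultrafilter ℕ, U + U = U → (∀ᶠ m in U, 0 < m) → A ∈ U) : IsIPStarSet A := by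
  rintro B hB ⟨x, -, hx⟩
  obtain ⟨U, hU, hxU⟩ := Hindman.exists_idempotent_ultrafilter_le_FS (x : Stream' ℕ)
  have hBU : B ∈ U := by
    filter_upwards [hxU] with m hm
    obtain ⟨H, hH, rfl⟩ := Hindman.exists_finset_sum_eq_of_mem_FS hm
    exact hx H hH
  exact Ultrafilter.nonempty_of_mem
    (Filter.inter_mem (hA U hU (Filter.mem_of_superset hBU hB)) hBU)

theorem Ultrafilter.eventually_eventually_add {U : Ultrafilter ℕ} (hU : U + U = U) {P : ℕ → Prop}
    (h : ∀ᶠ n in U, P n) : ∀ᶠ m in U, ∀ᶠ n in U, P (m + n) := by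
  rw [← hU] at h
  exact (Ultrafilter.eventually_add U U P).mp h

/-- Multiplication by `c` is additive, so it preserves idempotence. This gives mixing along the
multiples `c * h`. -/
theorem Ultrafilter.map_mul_left_add_self {U : Ultrafilter ℕ} (hU : U + U = U) (c : ℕ) :
    U.map (c * ·) + U.map (c * ·) = U.map (c * ·) := by
  refine Ultrafilter.coe_le_coe.mp fun s hs => ?_
  have hs' : ∀ᶠ n in U, c * n ∈ s := hs
  refine (Ultrafilter.eventually_add _ _ (· ∈ s)).mpr ?_
  simp only [Ultrafilter.coe_map, Filter.eventually_map]
  simpa only [mul_add] using Ultrafilter.eventually_eventually_add hU hs'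

/-! ### The van der Corput lemma along an idempotent ultrafilter -/

section VanDerCorput

variable {E : Type*} [NormedAddCommGroup E] [InnerProductSpace ℝ E]

/-- Expand the square: the diagonal gives at most `N * C`, the cross terms at most `N ^ 2 * η`. -/
theorem norm_sq_list_sum_le {C η : ℝ} (hη : 0 ≤ η) (l : List E) (hl : ∀ a ∈ l, ‖a‖ ^ 2 ≤ C)
    (hp : l.Pairwise fun a b => |inner ℝ a b| < η) :
    ‖l.sum‖ ^ 2 ≤ l.length * C + (l.length : ℝ) ^ 2 * η := by
  induction l with
  | nil => simp
  | cons a l ih =>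
    rw [List.pairwise_cons] at hp
    have h1 := ih (fun b hb => hl b (List.mem_cons_of_mem a hb)) hp.2
    have h2 : inner ℝ a l.sum ≤ l.length * η := by
      have h3 : ∀ b ∈ l, |inner ℝ a b| < η := hp.1
      clear ih hp h1 hl
      induction l with
      | nil => simp
      | cons b l ih =>
        have := ih fun c hc => h3 c (List.mem_cons_of_mem b hc)
        have hb := (abs_lt.mp (h3 b List.mem_cons_self)).2
        simp only [List.sum_cons, inner_add_right, List.length_cons, Nat.cast_add, Nat.cast_one]
        linarith
    have ha := hl a List.mem_cons_self
    rw [List.sum_cons, norm_add_sq_real]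
    simp only [List.length_cons, Nat.cast_add, Nat.cast_one]
    nlinarith

/-- If `u` has small correlations along an idempotent ultrafilter, then arbitrarily many terms of
`u` satisfying a prescribed large property are pairwise nearly orthogonal. -/
theorem exists_list_pairwise_inner_lt {U : Ultrafilter ℕ} (hU : U + U = U) {u : ℕ → E} {η : ℝ}
    (hu : ∀ᶠ h in U, ∀ᶠ n in U, |inner ℝ (u (h + n)) (u n)| < η) {P : ℕ → Prop}
    (hP : ∀ᶠ n in U, P n) (N : ℕ) :
    ∃ l : List ℕ, l.length = N ∧ (∀ a ∈ l, P a) ∧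
      l.Pairwise fun a b => |inner ℝ (u a) (u b)| < η := by
  -- The list is built up to a generic translate `n`. The extra correlation clauses make it possible
  -- to shift it by a suitable `m` and add `m` itself.
  suffices H : ∃ l : List ℕ, l.length = N ∧ ∀ᶠ n in U,
      (∀ a ∈ l, (P (a + n) ∧ ∀ᶠ k in U, |inner ℝ (u (a + n + k)) (u k)| < η) ∧
        |inner ℝ (u (a + n)) (u n)| < η) ∧
      l.Pairwise fun a b => |inner ℝ (u (a + n)) (u (b + n))| < η by
    obtain ⟨l, hl, h⟩ := H
    obtain ⟨n, hn, hp⟩ := h.exists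
    refine ⟨l.map (· + n), by simpa using hl, ?_, ?_⟩
    · intro a ha
      obtain ⟨b, hb, rfl⟩ := List.mem_map.mp ha
      exact (hn b hb).1.1
    · exact List.pairwise_map.mpr hp
  induction N with
  | zero => exact ⟨[], rfl, by simp⟩
  | succ N ih =>
    obtain ⟨l, hl, h⟩ := ih
    obtain ⟨m, ⟨h1, -⟩, h2, h3, h4, h5⟩ := (h.and
      ((Ultrafilter.eventually_eventually_add hU h).and
        ((Ultrafilter.eventually_eventually_add hU hP).and
          ((Ultrafilter.eventually_eventually_add hU hu).and hu)))).exists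
    refine ⟨m :: l.map (· + m), by simp [hl], ?_⟩
    have h6 : ∀ᶠ n in U, ∀ a ∈ l, |inner ℝ (u (a + m + n)) (u n)| < η := by
      have : ∀ a ∈ {a | a ∈ l}, ∀ᶠ n in U, |inner ℝ (u (a + m + n)) (u n)| < η :=
        fun a ha => (h1 a ha).1.2
      exact (Filter.eventually_all_finite (List.finite_toSet l)).mpr this
    filter_upwards [h2, h3, h4, h5, h6] with n k2 k3 k4 k5 k6
    constructor
    · intro a ha
      rcases List.mem_cons.mp ha with rfl | ha
      · exact ⟨⟨k3, k4⟩, k5⟩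
      · obtain ⟨b, hb, rfl⟩ := List.mem_map.mp ha
        exact ⟨by simpa only [add_assoc] using (k2.1 b hb).1, k6 b hb⟩
    · refine List.pairwise_cons.mpr ⟨?_, List.pairwise_map.mpr ?_⟩
      · intro a ha
        obtain ⟨b, hb, rfl⟩ := List.mem_map.mp ha
        rw [real_inner_comm]
        simpa only [add_assoc] using (k2.1 b hb).2
      · simpa only [add_assoc] using k2.2

/-- The van der Corput lemma for limits along an idempotent ultrafilter. -/
theorem tendsto_inner_zero_of_idempotent {U : Ultrafilter ℕ} (hU : U + U = U) {u : ℕ → E} {C : ℝ}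
    (hC : ∀ n, ‖u n‖ ^ 2 ≤ C)
    (hu : ∀ η > 0, ∀ᶠ h in U, ∀ᶠ n in U, |inner ℝ (u (h + n)) (u n)| < η) (v : E) :
    Tendsto (fun n => inner ℝ (u n) v) U (𝓝 0) := by
  have key : ∀ δ > 0, ∀ w : E, ∀ᶠ n in U, inner ℝ (u n) w < δ := by
    intro δ hδ w
    by_contra hcon
    have hP : ∀ᶠ n in U, δ ≤ inner ℝ (u n) w := by
      filter_upwards [Ultrafilter.eventually_not.mpr hcon] with n hn using not_lt.mp hn
    have hV : 0 < 2 * (‖w‖ ^ 2 + 1) := by positivity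
    -- For `N` nearly orthogonal terms, Cauchy–Schwarz gives `(N δ)² ≤ (N C + N² η) ‖w‖²`. This `η`
    -- and a large `N` keep each summand on the right below half of the left side; the `+ 1` covers
    -- `w = 0`.
    set η := δ ^ 2 / (2 * (‖w‖ ^ 2 + 1)) with hη_def
    have hη : 0 < η := by positivity
    have hηV : η * (‖w‖ ^ 2 + 1) * 2 = δ ^ 2 := by rw [hη_def]; field_simp
    obtain ⟨N, hN⟩ := exists_nat_gt (2 * (C * ‖w‖ ^ 2) / δ ^ 2)
    rw [div_lt_iff₀ (by positivity)] at hN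
    have hC0 : 0 ≤ C := (sq_nonneg _).trans (hC 0)
    have hNpos : (0 : ℝ) < N := by
      by_contra h0
      have : (N : ℝ) = 0 := le_antisymm (not_lt.mp h0) (Nat.cast_nonneg N)
      rw [this, zero_mul] at hN
      have : 0 ≤ C * ‖w‖ ^ 2 := by positivity
      linarith
    obtain ⟨l, hl, hlP, hlp⟩ := exists_list_pairwise_inner_lt hU (hu η hη) hP N
    have h1 := norm_sq_list_sum_le (C := C) hη.le (l.map u)
      (by intro a ha; obtain ⟨b, -, rfl⟩ := List.mem_map.mp ha; exact hC b)
      (List.pairwise_map.mpr hlp)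
    rw [List.length_map, hl] at h1
    have h2 : N * δ ≤ inner ℝ (l.map u).sum w := by
      rw [← hl]
      clear hl hlp h1
      induction l with
      | nil => simp
      | cons a l ih =>
        have := ih fun b hb => hlP b (List.mem_cons_of_mem a hb)
        have ha := hlP a List.mem_cons_self
        simp only [List.map_cons, List.sum_cons, inner_add_left, List.length_cons, Nat.cast_add,
          Nat.cast_one]
        linarith
    have h3 : N * δ ≤ ‖(l.map u).sum‖ * ‖w‖ := h2.trans (real_inner_le_norm _ _)
    have h4 : (N * δ) ^ 2 ≤ ‖(l.map u).sum‖ ^ 2 * ‖w‖ ^ 2 := by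
      rw [← mul_pow]
      exact pow_le_pow_left₀ (by positivity) h3 2
    have h5 : (N * δ) ^ 2 ≤ (N * C + (N : ℝ) ^ 2 * η) * ‖w‖ ^ 2 :=
      h4.trans (mul_le_mul_of_nonneg_right h1 (sq_nonneg _))
    have h6 : N * (2 * (C * ‖w‖ ^ 2)) < N * (N * δ ^ 2) := mul_lt_mul_of_pos_left hN hNpos
    have h7 : 0 ≤ (N : ℝ) ^ 2 * η := by positivity
    have h8 : (N : ℝ) ^ 2 * (η * (‖w‖ ^ 2 + 1) * 2) = N ^ 2 * δ ^ 2 := by rw [hηV]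
    nlinarith
  rw [Metric.tendsto_nhds]
  intro ε hε
  filter_upwards [key ε hε v, key ε hε (-v)] with n h1 h2
  rw [inner_neg_right] at h2
  rw [Real.dist_0_eq_abs, abs_lt]
  exact ⟨by linarith, h1⟩

end VanDerCorput

/-! ### Multiple mixing along idempotent ultrafilters -/

section MultipleMixing

variable {X : Type*} [MeasurableSpace X] {μ : Measure X} {T : X → X} {U : Ultrafilter ℕ}

theorem IsMildMixing.tendsto_measureReal_inter (hT : IsMildMixing μ T) (hU : U + U = U)
    (hpos : ∀ᶠ m in U, 0 < m) {A B : Set X} (hA : MeasurableSet A) (hB : MeasurableSet B) :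
    Tendsto (fun n => μ.real (A ∩ T^[n] ⁻¹' B)) U (𝓝 (μ.real A * μ.real B)) := by
  have := hT.isProbabilityMeasure
  -- Mild mixing only concerns sets of positive measure; for null sets both sides vanish.
  rcases eq_or_ne (μ A) 0 with hA0 | hA0
  · have h (n : ℕ) : μ.real (A ∩ T^[n] ⁻¹' B) = 0 := by
      simp [measureReal_def, measure_mono_null Set.inter_subset_left hA0]
    simp [h, measureReal_def, hA0]
  rcases eq_or_ne (μ B) 0 with hB0 | hB0
  · have h (n : ℕ) : μ.real (A ∩ T^[n] ⁻¹' B) = 0 := by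
      have h0 : μ (T^[n] ⁻¹' B) = 0 := by
        rw [(hT.measurePreserving.iterate n).measure_preimage hB.nullMeasurableSet, hB0]
      simp [measureReal_def, measure_mono_null Set.inter_subset_right h0]
    simp [h, measureReal_def, hB0]
  rw [Metric.tendsto_nhds]
  intro ε hε
  have h := (hT.isIPStarSet ε hε A B hA hB
    (pos_iff_ne_zero.mpr (mul_ne_zero hA0 hB0))).mem_ultrafilter hU hpos
  filter_upwards [h] with n hn
  exact hn.2

theorem MeasureTheory.SimpleFunc.piecewise_const_zero_apply (c : ℝ) {s : Set X}
    (hs : MeasurableSet s) (x : X) :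
    SimpleFunc.piecewise s hs (SimpleFunc.const X c) (SimpleFunc.const X 0) x =
      s.indicator (fun _ => c) x := by
  by_cases h : x ∈ s <;> simp [SimpleFunc.piecewise_apply, h]

theorem MeasureTheory.SimpleFunc.integrable_mul_comp [IsFiniteMeasure μ] {S : X → X}
    (hS : Measurable S) (f g : SimpleFunc X ℝ) : Integrable (fun x => f x * g (S x)) μ :=
  (f * g.comp S hS).integrable_of_isFiniteMeasure

/-- Both sides are bilinear in `f` and `g`, which reduces the claim to indicators. -/
theorem IsMildMixing.tendsto_integral_mul (hT : IsMildMixing μ T) (hU : U + U = U)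
    (hpos : ∀ᶠ m in U, 0 < m) (f g : SimpleFunc X ℝ) :
    Tendsto (fun n => ∫ x, f x * g (T^[n] x) ∂μ) U (𝓝 ((∫ x, f x ∂μ) * ∫ x, g x ∂μ)) := by
  have := hT.isProbabilityMeasure
  have hTm (n : ℕ) : Measurable T^[n] := hT.measurePreserving.measurable.iterate n
  have hint (f g : SimpleFunc X ℝ) (n : ℕ) : Integrable (fun x => f x * g (T^[n] x)) μ :=
    SimpleFunc.integrable_mul_comp (hTm n) f g
  induction f using SimpleFunc.induction with
  | @add f₁ f₂ _ h₁ h₂ =>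
    have h (n : ℕ) : ∫ x, (f₁ + f₂) x * g (T^[n] x) ∂μ =
        (∫ x, f₁ x * g (T^[n] x) ∂μ) + ∫ x, f₂ x * g (T^[n] x) ∂μ := by
      rw [← integral_add (hint f₁ g n) (hint f₂ g n)]
      simp [add_mul]
    have h' : ∫ x, (f₁ + f₂) x ∂μ = (∫ x, f₁ x ∂μ) + ∫ x, f₂ x ∂μ :=
      integral_add f₁.integrable_of_isFiniteMeasure f₂.integrable_of_isFiniteMeasure
    simpa only [h, h', add_mul] using h₁.add h₂
  | @const c s hs =>
    induction g using SimpleFunc.induction with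
    | @add g₁ g₂ _ h₁ h₂ =>
      set f := SimpleFunc.piecewise s hs (SimpleFunc.const X c) (SimpleFunc.const X 0)
      have h (n : ℕ) : ∫ x, f x * (g₁ + g₂) (T^[n] x) ∂μ =
          (∫ x, f x * g₁ (T^[n] x) ∂μ) + ∫ x, f x * g₂ (T^[n] x) ∂μ := by
        rw [← integral_add (hint f g₁ n) (hint f g₂ n)]
        simp [mul_add]
      have h' : ∫ x, (g₁ + g₂) x ∂μ = (∫ x, g₁ x ∂μ) + ∫ x, g₂ x ∂μ :=
        integral_add g₁.integrable_of_isFiniteMeasure g₂.integrable_of_isFiniteMeasure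
      simpa only [h, h', mul_add] using h₁.add h₂
    | @const d t ht =>
      have h (n : ℕ) (x : X) : s.indicator (fun _ => c) x * t.indicator (fun _ => d) (T^[n] x) =
          (s ∩ T^[n] ⁻¹' t).indicator (fun _ => c * d) x := by
        by_cases h1 : x ∈ s <;> by_cases h2 : T^[n] x ∈ t <;> simp [h1, h2]
      simp only [SimpleFunc.piecewise_const_zero_apply, h, integral_indicator_const _ hs, integral_indicator_const _ ht,
        integral_indicator_const _ (hs.inter (hTm _ ht)), smul_eq_mul]
      convert! (hT.tendsto_measureReal_inter hU hpos hs ht).mul_const (c * d) using 2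
      ring

/-- Keeps the products within simple functions, where integrability and membership in L² are
automatic. -/
theorem MeasureTheory.SimpleFunc.exists_eq_prod {ι : Type*} (s : Finset ι)
    (f : ι → SimpleFunc X ℝ) {S : ι → X → X} (hS : ∀ i, Measurable (S i)) :
    ∃ g : SimpleFunc X ℝ, ∀ x, g x = ∏ i ∈ s, f i (S i x) := by
  classical
  induction s using Finset.induction_on with
  | empty => exact ⟨SimpleFunc.const X 1, by simp⟩
  | insert i s hi ih =>
    obtain ⟨g, hg⟩ := ih
    exact ⟨(f i).comp (S i) (hS i) * g, fun x => by simp [Finset.prod_insert hi, hg]⟩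

theorem MeasureTheory.SimpleFunc.inner_toLp [IsFiniteMeasure μ] (f g : SimpleFunc X ℝ) :
    inner ℝ ((f.memLp_of_isFiniteMeasure 2 μ).toLp f) ((g.memLp_of_isFiniteMeasure 2 μ).toLp g) =
      ∫ x, f x * g x ∂μ := by
  rw [L2.inner_def]
  refine integral_congr_ae ?_
  filter_upwards [(f.memLp_of_isFiniteMeasure 2 μ).coeFn_toLp,
    (g.memLp_of_isFiniteMeasure 2 μ).coeFn_toLp] with x hf hg
  rw [hf, hg]
  exact mul_comm _ _

/-- The inductive step of multiple mixing when the last function has mean zero. -/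
theorem IsMildMixing.tendsto_integral_prod_of_integral_eq_zero (hT : IsMildMixing μ T)
    (hU : U + U = U) (hpos : ∀ᶠ m in U, 0 < m) {k : ℕ}
    (ih : ∀ f : ℕ → SimpleFunc X ℝ,
      Tendsto (fun n => ∫ x, ∏ i ∈ Finset.range (k + 1), f i (T^[i * n] x) ∂μ) U
        (𝓝 (∏ i ∈ Finset.range (k + 1), ∫ x, f i x ∂μ)))
    (f : ℕ → SimpleFunc X ℝ) (hf : ∫ x, f (k + 1) x ∂μ = 0) :
    Tendsto (fun n => ∫ x, ∏ i ∈ Finset.range (k + 2), f i (T^[i * n] x) ∂μ) U (𝓝 0) := by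
  have := hT.isProbabilityMeasure
  have hTm (n : ℕ) : Measurable T^[n] := hT.measurePreserving.measurable.iterate n
  -- The factor `i = 0` is left out of `u n`: it serves as the fixed test vector in van der Corput.
  choose u hu using fun n : ℕ => SimpleFunc.exists_eq_prod (Finset.range (k + 1))
    (fun i => f (i + 1)) fun i => hTm ((i + 1) * n)
  choose C hC using fun i => (f i).exists_forall_norm_le
  have hbound (n : ℕ) (x : X) : |u n x| ≤ ∏ i ∈ Finset.range (k + 1), C (i + 1) := by
    rw [hu, Finset.abs_prod]
    exact Finset.prod_le_prod (fun _ _ => abs_nonneg _) fun i _ => hC (i + 1) _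
  -- Every exponent in `u (h + n) * u n` contains at least `n`. Invariance of `μ` removes `T^[n]`,
  -- leaving the exponents `i * n` with `i ≤ k` to which `ih` applies.
  have hcorr (h : ℕ) : Tendsto (fun n => ∫ x, u (h + n) x * u n x ∂μ) U
      (𝓝 (∏ i ∈ Finset.range (k + 1), ∫ x, f (i + 1) x * f (i + 1) (T^[(i + 1) * h] x) ∂μ)) := by
    refine (ih fun i => f (i + 1) * (f (i + 1)).comp _ (hTm ((i + 1) * h))).congr fun n => ?_
    obtain ⟨g, hg⟩ := SimpleFunc.exists_eq_prod (Finset.range (k + 1))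
      (fun i => f (i + 1) * (f (i + 1)).comp _ (hTm ((i + 1) * h))) fun i => hTm (i * n)
    simp only [← hg]
    have hmp := hT.measurePreserving.iterate n
    have hmap : ∫ x, g x ∂μ = ∫ x, g (T^[n] x) ∂μ := by
      conv_lhs => rw [← hmp.map_eq]
      exact integral_map hmp.aemeasurable g.aestronglyMeasurable
    rw [hmap]
    refine integral_congr_ae (ae_of_all _ fun x => ?_)
    simp only [hg, hu, ← Finset.prod_mul_distrib]
    refine Finset.prod_congr rfl fun i _ => ?_
    simp only [SimpleFunc.coe_mul, Pi.mul_apply, SimpleFunc.coe_comp, Function.comp_apply,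
      ← Function.iterate_add_apply]
    rw [mul_comm]
    congr 4 <;> ring
  have hlim : Tendsto (fun h => ∏ i ∈ Finset.range (k + 1),
      ∫ x, f (i + 1) x * f (i + 1) (T^[(i + 1) * h] x) ∂μ) U (𝓝 0) := by
    -- By mixing along `(i + 1) * h`, each factor tends to the square of a mean; the one with `i =
    -- k` is zero.
    have h0 : ∏ i ∈ Finset.range (k + 1), ((∫ x, f (i + 1) x ∂μ) * ∫ x, f (i + 1) x ∂μ) = 0 :=
      Finset.prod_eq_zero (Finset.self_mem_range_succ k) (by simp [hf])
    rw [← h0]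
    refine tendsto_finsetProd _ fun i _ => ?_
    have hpos' : ∀ᶠ m in U.map ((i + 1) * ·), 0 < m := by
      rw [Ultrafilter.coe_map, eventually_map]
      filter_upwards [hpos] with m hm using by positivity
    have h1 := hT.tendsto_integral_mul (Ultrafilter.map_mul_left_add_self hU (i + 1)) hpos'
      (f (i + 1)) (f (i + 1))
    rwa [Ultrafilter.coe_map, tendsto_map'_iff] at h1
  have hvdc := tendsto_inner_zero_of_idempotent hU
    (u := fun n => ((u n).memLp_of_isFiniteMeasure 2 μ).toLp (u n))
    (C := (∏ i ∈ Finset.range (k + 1), C (i + 1)) ^ 2)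
    (fun n => by
      rw [← real_inner_self_eq_norm_sq, SimpleFunc.inner_toLp]
      have hle : ∫ x, u n x * u n x ∂μ ≤
          ∫ _, (∏ i ∈ Finset.range (k + 1), C (i + 1)) ^ 2 ∂μ := by
        refine integral_mono (u n * u n).integrable_of_isFiniteMeasure (integrable_const _)
          fun x => ?_
        change u n x * u n x ≤ _
        rw [← sq, ← sq_abs]
        exact pow_le_pow_left₀ (abs_nonneg _) (hbound n x) 2
      simpa using hle)
    (fun η hη => by
      simp only [SimpleFunc.inner_toLp]
      have hη' := hlim.abs.eventually_lt_const (by simpa using hη)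
      filter_upwards [hη'] with h hh
      exact (hcorr h).abs.eventually_lt_const hh)
    (((f 0).memLp_of_isFiniteMeasure 2 μ).toLp (f 0))
  refine hvdc.congr fun n => ?_
  rw [SimpleFunc.inner_toLp]
  refine integral_congr_ae (ae_of_all _ fun x => ?_)
  simp [Finset.prod_range_succ' _ (k + 1), hu]

/-- A mild mixing system is mixing of all orders along idempotent ultrafilters. -/
theorem IsMildMixing.tendsto_integral_prod (hT : IsMildMixing μ T)
    (hU : U + U = U) (hpos : ∀ᶠ m in U, 0 < m) (k : ℕ) (f : ℕ → SimpleFunc X ℝ) :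
    Tendsto (fun n => ∫ x, ∏ i ∈ Finset.range (k + 1), f i (T^[i * n] x) ∂μ) U
      (𝓝 (∏ i ∈ Finset.range (k + 1), ∫ x, f i x ∂μ)) := by
  have := hT.isProbabilityMeasure
  have hTm (n : ℕ) : Measurable T^[n] := hT.measurePreserving.measurable.iterate n
  induction k generalizing f with
  | zero => simp
  | succ k ih =>
    -- Split the last function into its mean-zero part and the constant `c`, which reduces to `k`.
    set c := ∫ x, f (k + 1) x ∂μ with hc
    let f' : ℕ → SimpleFunc X ℝ :=
      Function.update f (k + 1) (f (k + 1) - SimpleFunc.const X c)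
    have hne {i : ℕ} (hi : i ∈ Finset.range (k + 1)) : f' i = f i :=
      Function.update_of_ne (Finset.mem_range.mp hi).ne _ _
    have hf' : f' (k + 1) = f (k + 1) - SimpleFunc.const X c := Function.update_self ..
    have hmean : ∫ x, f' (k + 1) x ∂μ = 0 := by
      have : ∫ x, f' (k + 1) x ∂μ = ∫ x, (f (k + 1) x - c) ∂μ := by simp [hf']
      rw [this, integral_sub (f (k + 1)).integrable_of_isFiniteMeasure (integrable_const _)]
      simp [hc]
    have h := (hT.tendsto_integral_prod_of_integral_eq_zero hU hpos ih f' hmean).add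
      ((ih f).mul_const c)
    rw [zero_add, ← Finset.prod_range_succ (fun i => ∫ x, f i x ∂μ)] at h
    refine h.congr fun n => ?_
    obtain ⟨g, hg⟩ := SimpleFunc.exists_eq_prod (Finset.range (k + 1)) f fun i => hTm (i * n)
    obtain ⟨g', hg'⟩ := SimpleFunc.exists_eq_prod (Finset.range (k + 1 + 1)) f'
      fun i => hTm (i * n)
    simp only [← hg, ← hg']
    rw [← integral_mul_const, ← integral_add g'.integrable_of_isFiniteMeasure
      (g.integrable_of_isFiniteMeasure.mul_const c)]
    refine integral_congr_ae (ae_of_all _ fun x => ?_)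
    have hp : ∏ i ∈ Finset.range (k + 1), f' i (T^[i * n] x) = g x := by
      rw [hg]
      exact Finset.prod_congr rfl fun i hi => by rw [hne hi]
    simp only [hg', Finset.prod_range_succ _ (k + 1), hp, ← hg, hf', SimpleFunc.coe_sub,
      Pi.sub_apply, SimpleFunc.const_apply]
    ring

/-- Multiple recurrence in mild mixing systems takes place along an IP⋆-set. -/
theorem IsMildMixing.isIPStarSet_measure_iInter_pos (hT : IsMildMixing μ T) (k : ℕ)
    {A : Fin (k + 1) → Set X} (hA : ∀ i, MeasurableSet (A i)) (hpos : ∀ i, 0 < μ (A i)) :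
    IsIPStarSet
      {m : ℕ | 0 < m ∧ 0 < μ (⋂ i : Fin (k + 1), T^[(i : ℕ) * m] ⁻¹' (A i))} := by
  have := hT.isProbabilityMeasure
  refine isIPStarSet_of_forall_ultrafilter fun U hU hU0 => ?_
  let f : ℕ → SimpleFunc X ℝ := fun i => if h : i < k + 1 then
    SimpleFunc.piecewise (A ⟨i, h⟩) (hA ⟨i, h⟩) (SimpleFunc.const X 1) (SimpleFunc.const X 0)
    else 0
  have hf (i : Fin (k + 1)) (x : X) : f i x = (A i).indicator 1 x := by
    simp only [f, i.isLt, dif_pos, SimpleFunc.piecewise_const_zero_apply]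
    rfl
  have hlim := hT.tendsto_integral_prod hU hU0 k f
  have hprod : 0 < ∏ i ∈ Finset.range (k + 1), ∫ x, f i x ∂μ := by
    rw [Finset.prod_range]
    refine Finset.prod_pos fun i _ => ?_
    simp only [hf, integral_indicator_one (hA i)]
    exact ENNReal.toReal_pos (hpos i).ne' (measure_ne_top μ _)
  filter_upwards [hlim.eventually_const_lt hprod, hU0] with m hm hm0
  refine ⟨hm0, pos_iff_ne_zero.mpr fun h0 => hm.ne' (integral_eq_zero_of_ae ?_)⟩
  filter_upwards [measure_eq_zero_iff_ae_notMem.mp h0] with x hx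
  obtain ⟨i, hi⟩ := by simpa using hx
  rw [Finset.prod_range]
  exact Finset.prod_eq_zero (Finset.mem_univ i) (by simp [hf, hi])

end MultipleMixing

/-! ### From IP⋆ to IPⁿ⋆ by translation -/

theorem mainTheorem5 {X : Type*} [MeasurableSpace X] (μ : Measure X) (T : X → X)
    (hT : IsMildMixing μ T) (k n : ℕ) (hk : 1 ≤ k) (hn : 1 ≤ n)
    (A : Fin (k + 1) → Set X) (hA : ∀ i, MeasurableSet (A i)) (hpos : 0 < ∏ i, μ (A i)) :
    IsIPnStarSet n
      {m : ℕ | 0 < m ∧ 0 < μ (⋂ i : Fin (k + 1), T^[(i : ℕ) * m] ⁻¹' (A i))} := by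
  obtain ⟨n, rfl⟩ := Nat.exists_eq_add_of_le' hn
  rintro B hB ⟨x, hx, hxB⟩
  have hmp (m : ℕ) := hT.measurePreserving.iterate m
  have hApos (i : Fin (k + 1)) : 0 < μ (A i) :=
    pos_iff_ne_zero.mpr (Finset.prod_ne_zero_iff.mp hpos.ne' i (Finset.mem_univ i))
  -- Here `n` is one less than the original. The choice `H i = {i}` freezes the first `n` sequences;
  -- the shift by `n` in `y` puts the last index set after them.
  set c := ∑ i : Fin n, x i.castSucc i with hc
  let y : ℕ → ℕ := fun t => x (Fin.last n) (t + n)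
  have hsum (K : Finset ℕ) (hK : K.Nonempty) : c + ∑ t ∈ K, y t ∈ B := by
    have h := hxB (Fin.snoc (α := fun _ => Finset ℕ) (fun i : Fin n => {(i : ℕ)})
      (K.map (addRightEmbedding n))) ?_ ?_
    · simpa [Fin.sum_univ_castSucc, hc, y] using h
    · intro i
      induction i using Fin.lastCases with
      | last => simpa using hK
      | cast i => simp
    · intro i j hij s hs t ht
      induction i using Fin.lastCases with
      | last => exact absurd hij (Fin.le_last j).not_gt
      | cast i =>
        induction j using Fin.lastCases with
        | last =>
          simp only [Fin.snoc_castSucc, Fin.snoc_last, Finset.mem_singleton, Finset.mem_map,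
            addRightEmbedding_apply] at hs ht
          obtain ⟨a, -, rfl⟩ := ht
          have := i.isLt
          omega
        | cast j =>
          simp only [Fin.snoc_castSucc, Finset.mem_singleton] at hs ht
          have : (i : ℕ) < j := hij
          omega
  -- Pulling `A i` back by `T^[i * c]` turns a return time `m` into the return time `c + m` for the
  -- original sets.
  obtain ⟨m, ⟨hm0, hm⟩, H, hH, rfl⟩ := hT.isIPStarSet_measure_iInter_pos k
    (A := fun i => T^[(i : ℕ) * c] ⁻¹' (A i)) (fun i => (hmp _).measurable (hA i))
    (fun i => by rw [(hmp _).measure_preimage (hA i).nullMeasurableSet]; exact hApos i)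
    {m | ∃ H : Finset ℕ, H.Nonempty ∧ ∑ t ∈ H, y t = m}
    (by rintro _ ⟨H, hH, rfl⟩; exact Finset.sum_pos (fun t _ => hx _ _) hH)
    ⟨y, fun t => hx _ _, fun H hH => ⟨H, hH, rfl⟩⟩
  refine ⟨c + ∑ t ∈ H, y t, ⟨hB _ (hsum H hH), ?_⟩, hsum H hH⟩
  simpa only [← Set.preimage_comp, ← Function.iterate_add, ← mul_add] using hm
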